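/- Let $n\ge 1$ be an integer, let $M_n$ be the $C^*$-algebra of complex $n\times n$ matrices, let $U(n)$ be its unitary group, and let $\mathcal U_n = U(n)/\{zI : z\in\mathbb C,\ |z|=1\}$ with the quotient topology. The group $\mathcal U_n$ acts on $M_n$ by $\mathfrak u.A = UAU^{-1}$, where $U$ is any representative of $\mathfrak u$. An $n$-space $(X,.)$ is a locally compact Hausdorff space $X$ with a continuous free action $\mathcal U_n\times X\ni(\mathfrak u,x)\mapsto \mathfrak u.x\in X$ (free: if $\mathfrak u.x=x$ for some $x \in X$, then $\mathfrak u$ is the neutral element). Let $C^*(X,.)$ be the $C^*$-algebra, with pointwise operations and supremum norm, of all continuous $f\colon X\to M_n$ that vanish at infinity and satisfy $f(\mathfrak u.x)=\mathfrak u.f(x)$ for all $\mathfrak u\in\mathcal U_n$ and $x\in X$. Let $(X,.)$ be an $n$-space, let $H$ be a complex Hilbert space, and let $\pi\colon C^*(X,.)\to B(H)$ be a nonzero $*$-homomorphism that is irreducible, i.e. $\{0\}$ and $H$ are the only closed subspaces of $H$ invariant under all $\pi(f)$. Then $\dim H=n$, and $\pi$ has the form $\pi(f)=f(x)$: for every unitary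 identification $W\colon H\to\mathbb C^n$ there is a point $x\in X$ such that $W\pi(f)W^{-1}=f(x)$ for all $f\in C^*(X,.)$. In particular, such $W$ and $x$ exist. -/

import Mathlib

open scoped ZeroAtInfty

noncomputable section

/-- The full matrix algebra `M_n` of complex `n × n` matrices. -/
abbrev Mat (n : ℕ) : Type := Matrix (Fin n) (Fin n) ℂ

/-- The subgroup `𝕋 · I` of the unitary group of `M_n`. -/
def scalarUnitaries (n : ℕ) : Subgroup (Matrix.unitaryGroup (Fin n) ℂ) where
  carrier := {U | ∃ z : ℂ, ‖z‖ = 1 ∧ (U : Mat n) = z • (1 : Mat n)}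
  one_mem' := ⟨1, by simp⟩
  mul_mem' := by
    rintro U V ⟨z, hz, hU⟩ ⟨w, hw, hV⟩
    exact ⟨z * w, by simp [hz, hw], by simp [hU, hV, smul_smul, mul_comm]⟩
  inv_mem' := by
    rintro U ⟨z, hz, hU⟩
    exact ⟨star z, by simpa using hz, by
      rw [← Unitary.star_eq_inv, Unitary.coe_star, hU, star_smul, star_one]⟩

instance scalarUnitaries_normal (n : ℕ) : (scalarUnitaries n).Normal where
  conj_mem := by
    rintro U ⟨z, hz, hU⟩ V
    refine ⟨z, hz, ?_⟩
    rw [Submonoid.coe_mul, Submonoid.coe_mul, hU, mul_smul_comm, mul_one, smul_mul_assoc,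
      ← Submonoid.coe_mul, mul_inv_cancel, Submonoid.coe_one]

/-- The group `𝓤_n = U(n) / (𝕋 · I)`, with the quotient topology. -/
abbrev ProjUnitary (n : ℕ) : Type := Matrix.unitaryGroup (Fin n) ℂ ⧸ scalarUnitaries n

/-- The action of `𝓤_n` on `M_n` by conjugation: the class of `U` sends `A` to `U A U⁻¹`. -/
def ProjUnitary.conj (n : ℕ) : ProjUnitary n →* (Mat n ≃⋆ₐ[ℂ] Mat n) :=
  QuotientGroup.lift (scalarUnitaries n) (Unitary.conjStarAlgAut ℂ (Mat n)) (by
    rintro U ⟨z, hz, hU⟩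
    ext1 A
    have h : z * (starRingEnd ℂ) z = 1 := by
      rw [Complex.mul_conj, Complex.normSq_eq_norm_sq, hz]; simp
    simp [Unitary.conjStarAlgAut_apply, hU, smul_smul, h, mul_comm])

theorem ProjUnitary.conj_mk {n : ℕ} (U : Matrix.unitaryGroup (Fin n) ℂ) (A : Mat n) :
    ProjUnitary.conj n (QuotientGroup.mk U) A = (U : Mat n) * A * ((U⁻¹ : _) : Mat n) := rfl

/-- An `n`-space: a locally compact Hausdorff space with a continuous free action of `𝓤_n`. -/
class IsNSpace (n : ℕ) (X : Type*) [TopologicalSpace X] [MulAction (ProjUnitary n) X] :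
    Prop where
  t2 : T2Space X
  locallyCompact : LocallyCompactSpace X
  continuous_smul : Continuous fun p : ProjUnitary n × X => p.1 • p.2
  free : ∀ (u : ProjUnitary n) (x : X), u • x = x → u = 1

/-- `C*(X, .)`: the `*`-algebra, under pointwise operations, of the continuous maps `X → M_n`
that vanish at infinity and satisfy `f (u . x) = u . f x`. -/
def CStarNSpace (n : ℕ) (X : Type*) [TopologicalSpace X] [MulAction (ProjUnitary n) X] :
    NonUnitalStarSubalgebra ℂ C₀(X, Mat n) where
  carrier := {f | ∀ (u : ProjUnitary n) (x : X), f (u • x) = ProjUnitary.conj n u (f x)}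
  add_mem' := by
    intro f g hf hg u x
    simp [hf u x, hg u x]
  zero_mem' := by
    intro u x
    simp
  mul_mem' := by
    intro f g hf hg u x
    simp [hf u x, hg u x]
  smul_mem' := by
    intro c f hf u x
    simp [hf u x]
  star_mem' := by
    intro f hf u x
    simp only [ZeroAtInftyContinuousMap.star_apply]
    rw [hf u x, map_star]

/-- A representation of a `*`-algebra on a Hilbert space is (topologically) irreducible if `{0}`
and the whole space are its only closed invariant subspaces. -/
def IsIrreducibleRep {A H : Type*} [NonUnitalNonAssocSemiring A] [Module ℂ A] [Star A]
    [NormedAddCommGroup H] [InnerProductSpace ℂ H] [CompleteSpace H]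
    (π : A →⋆ₙₐ[ℂ] (H →L[ℂ] H)) : Prop :=
  ∀ K : Submodule ℂ H, IsClosed (K : Set H) → (∀ a : A, ∀ v ∈ K, π a v ∈ K) → K = ⊥ ∨ K = ⊤

end

/-! ### Norm estimates and truncation in `C*(X, .)` -/

section FunctionAlgebra

open scoped Matrix.Norms.L2Operator

variable {n : ℕ} {X : Type*} [TopologicalSpace X] [MulAction (ProjUnitary n) X]

/-! The kernel of `π` is exactly the set of functions vanishing at some point `x`. If the kernel had
no common zero, then over any compact set it would contain a positive definite `s`; dividing by `s`
puts compactly supported truncations of every `f` into the kernel, and contractivity of `π` gives `π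
= 0`. Conversely, irreducibility makes the kernel prime, and a cut-off near `x` shows that any `f`
with `f x = 0` is killed (`IsIrreducibleRep.exists_map_eq_zero_iff`).

Evaluation at `x` is onto `M_n`, by Haar averaging and freeness (`CStarNSpace.exists_apply_eq`), so
`π` factors through an irreducible representation of `M_n`, which is the identity one up to a
unitary. Two identifications of `H` differ by some `U` in `U(n)`, and equivariance absorbs `U` by
moving `x` along its orbit. -/

theorem ProjUnitary.norm_conj (u : ProjUnitary n) (A : Mat n) :
    ‖ProjUnitary.conj n u A‖ = ‖A‖ := StarAlgEquiv.norm_map _ A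

theorem ProjUnitary.continuous_conj (u : ProjUnitary n) : Continuous (ProjUnitary.conj n u) :=
  (ProjUnitary.conj n u : Mat n →ₗ[ℂ] Mat n).continuous_of_finiteDimensional

theorem CStarNSpace.apply_smul (f : CStarNSpace n X) (u : ProjUnitary n) (x : X) :
    f.1 (u • x) = ProjUnitary.conj n u (f.1 x) := f.2 u x

/-- Closedness makes `C*(X, .)` complete, hence a C*-algebra, so that its `*`-homomorphisms are
automatically contractive. -/
theorem CStarNSpace.isClosed : IsClosed (CStarNSpace n X : Set C₀(X, Mat n)) := by
  have h : (CStarNSpace n X : Set C₀(X, Mat n)) =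
      ⋂ (u : ProjUnitary n) (x : X),
        {f : C₀(X, Mat n) | f (u • x) = ProjUnitary.conj n u (f x)} := by
    ext f
    simp only [Set.mem_iInter]
    rfl
  have hev (x : X) : Continuous fun f : C₀(X, Mat n) => f x :=
    (continuous_eval_const (F := BoundedContinuousFunction X (Mat n)) x).comp
      ZeroAtInftyContinuousMap.isometry_toBCF.continuous
  rw [h]
  exact isClosed_iInter fun u => isClosed_iInter fun x =>
    isClosed_eq (hev _) ((ProjUnitary.continuous_conj u).comp (hev x))

theorem CStarNSpace.norm_map_le {H : Type*} [NormedAddCommGroup H] [InnerProductSpace ℂ H]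
    [CompleteSpace H] (π : CStarNSpace n X →⋆ₙₐ[ℂ] (H →L[ℂ] H)) (f : CStarNSpace n X) :
    ‖π f‖ ≤ ‖f.1‖ := by
  have : IsClosed (CStarNSpace n X : Set C₀(X, Mat n)) := CStarNSpace.isClosed
  exact NonUnitalStarAlgHom.norm_apply_le π f

theorem ZeroAtInftyContinuousMap.isCompact_le_norm {Y E : Type*} [TopologicalSpace Y]
    [NormedAddCommGroup E] (f : C₀(Y, E)) {ε : ℝ} (hε : 0 < ε) :
    IsCompact {x | ε ≤ ‖f x‖} := by
  have h : ∀ᶠ x in Filter.cocompact Y, ‖f x‖ < ε := by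
    have := (f.zero_at_infty').norm
    rw [norm_zero] at this
    exact this.eventually_lt_const hε
  obtain ⟨K, hK, hKs⟩ := Filter.mem_cocompact.1 h
  refine hK.of_isClosed_subset (isClosed_le continuous_const (by fun_prop)) fun x hx => ?_
  by_contra hxK
  exact (show ‖f x‖ < ε from hKs hxK).not_ge (show ε ≤ ‖f x‖ from hx)

/-- The product of an element of `C*(X, .)` with an invariant function bounded by `1`. -/
noncomputable def CStarNSpace.invMul (h : X → ℝ) (hc : Continuous h) (h1 : ∀ x, |h x| ≤ 1)
    (hinv : ∀ (u : ProjUnitary n) (x : X), h (u • x) = h x) (f : CStarNSpace n X) :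
    CStarNSpace n X :=
  ⟨⟨⟨fun x => (h x : ℂ) • f.1 x, by fun_prop⟩, by
      refine squeeze_zero_norm (a := fun x => ‖f.1 x‖) (fun x => ?_) ?_
      · rw [norm_smul, Complex.norm_real, Real.norm_eq_abs]
        exact mul_le_of_le_one_left (norm_nonneg _) (h1 x)
      · simpa using (f.1.zero_at_infty').norm⟩, fun u x => by
      change (h (u • x) : ℂ) • f.1 (u • x) = ProjUnitary.conj n u ((h x : ℂ) • f.1 x)
      rw [hinv, CStarNSpace.apply_smul, map_smul]⟩

@[simp]
theorem CStarNSpace.invMul_apply (h : X → ℝ) (hc : Continuous h) (h1 : ∀ x, |h x| ≤ 1)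
    (hinv : ∀ (u : ProjUnitary n) (x : X), h (u • x) = h x) (f : CStarNSpace n X) (x : X) :
    (CStarNSpace.invMul h hc h1 hinv f).1 x = (h x : ℂ) • f.1 x := rfl

/-- An equivariant continuous function with compact support, as an element of `C*(X, .)`. -/
def CStarNSpace.ofCompactSupport (g : X → Mat n) (hc : Continuous g) (hs : HasCompactSupport g)
    (hg : ∀ (u : ProjUnitary n) (x : X), g (u • x) = ProjUnitary.conj n u (g x)) :
    CStarNSpace n X :=
  ⟨⟨⟨g, hc⟩, hs.is_zero_at_infty⟩, hg⟩

theorem CStarNSpace.norm_apply_smul (f : CStarNSpace n X) (u : ProjUnitary n) (x : X) :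
    ‖f.1 (u • x)‖ = ‖f.1 x‖ := by
  rw [CStarNSpace.apply_smul, ProjUnitary.norm_conj]

/-- Soft thresholding: scaling `f` by `1 - ε / max ε ‖f‖` lowers the norm by at most `ε` at each
point. The factor is invariant because conjugation is isometric. -/
theorem CStarNSpace.exists_truncation (f : CStarNSpace n X) {ε : ℝ} (hε : 0 < ε) :
    ∃ g : CStarNSpace n X, ‖(f - g).1‖ ≤ ε ∧ ∀ x, ‖f.1 x‖ ≤ ε → g.1 x = 0 := by
  have hpos (t : ℝ) : 0 < max ε t := lt_max_of_lt_left hε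
  have h01 (t : ℝ) : 0 ≤ ε / max ε t ∧ ε / max ε t ≤ 1 :=
    ⟨by have := hpos t; positivity, (div_le_one (hpos t)).2 (le_max_left _ _)⟩
  refine ⟨CStarNSpace.invMul (fun x => 1 - ε / max ε ‖f.1 x‖) ?_ (fun x => ?_) (fun u x => ?_) f,
    ?_, fun x hx => ?_⟩
  · refine continuous_const.sub (continuous_const.div (by fun_prop) fun x => (hpos _).ne')
  · have := h01 ‖f.1 x‖
    rw [abs_le]
    constructor <;> linarith
  · simp only [CStarNSpace.norm_apply_smul]
  · refine (BoundedContinuousFunction.norm_le hε.le).2 fun x => ?_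
    change ‖f.1 x - ((1 - ε / max ε ‖f.1 x‖ : ℝ) : ℂ) • f.1 x‖ ≤ ε
    have h : f.1 x - ((1 - ε / max ε ‖f.1 x‖ : ℝ) : ℂ) • f.1 x =
        ((ε / max ε ‖f.1 x‖ : ℝ) : ℂ) • f.1 x := by
      push_cast
      rw [sub_smul, one_smul, sub_sub_cancel]
    rw [h, norm_smul, Complex.norm_real, Real.norm_of_nonneg (h01 _).1, div_mul_eq_mul_div,
      div_le_iff₀ (hpos _)]
    exact mul_le_mul_of_nonneg_left (le_max_right _ _) hε.le
  · simp [max_eq_left hx, hε.ne']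

end FunctionAlgebra

/-! ### Primeness of the kernel -/

section Irreducible

open scoped Matrix.Norms.L2Operator

variable {n : ℕ} {X : Type*} [TopologicalSpace X] [MulAction (ProjUnitary n) X]
  {H : Type*} [NormedAddCommGroup H] [InnerProductSpace ℂ H] [CompleteSpace H]

/-- The kernel of an irreducible representation is a prime ideal. -/
theorem IsIrreducibleRep.map_eq_zero_or {A : Type*} [NonUnitalRing A] [Module ℂ A] [StarRing A]
    {π : A →⋆ₙₐ[ℂ] (H →L[ℂ] H)} (hirr : IsIrreducibleRep π) {f g : A}
    (h : ∀ a, π (f * a * g) = 0) : π f = 0 ∨ π g = 0 := by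
  -- `K` is closed and invariant. If it is `⊥`, the range of `π g` lies in it and `π g = 0`; if it
  -- is `⊤`, then `π f * star (π f) = 0`.
  let K : Submodule ℂ H := ⨅ a : A, (π f * π a : H →L[ℂ] H).ker
  have hK (w : H) : w ∈ K ↔ ∀ a, π f (π a w) = 0 := by
    simp [K]
  have hclosed : IsClosed (K : Set H) := by
    have : (K : Set H) = ⋂ a : A, {w | π f (π a w) = 0} := by
      ext w
      simpa using hK w
    rw [this]
    exact isClosed_iInter fun a => isClosed_eq (by fun_prop) continuous_const
  rcases hirr K hclosed (fun a v hv => (hK _).2 fun b => by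
    simpa using (hK v).1 hv (b * a)) with hbot | htop
  · right
    ext v
    have : π g v ∈ K := (hK _).2 fun a => by simpa using congrArg (fun T => T v) (h a)
    simpa [hbot] using this
  · left
    have h0 : π f * star (π f) = 0 := by
      ext v
      have : v ∈ K := htop ▸ Submodule.mem_top
      simpa [map_star] using (hK v).1 this (star f)
    exact (CStarRing.mul_star_self_eq_zero_iff _).1 h0

/-- With `ε = ‖π f‖ / 2`, the truncation `f'` of `f` satisfies `f' * a * g = 0` for every `a`, and
`π f' ≠ 0` by contractivity; primeness leaves `π g = 0`. -/
theorem IsIrreducibleRep.exists_pos_map_eq_zero {π : CStarNSpace n X →⋆ₙₐ[ℂ] (H →L[ℂ] H)}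
    (hirr : IsIrreducibleRep π) {f : CStarNSpace n X} (hf : π f ≠ 0) :
    ∃ ε > 0, ∀ g : CStarNSpace n X, (∀ x, ε ≤ ‖f.1 x‖ → g.1 x = 0) → π g = 0 := by
  have hpos : 0 < ‖π f‖ := norm_pos_iff.2 hf
  obtain ⟨f', hle, hf'⟩ := CStarNSpace.exists_truncation f (half_pos hpos)
  refine ⟨‖π f‖ / 2, half_pos hpos, fun g hg => ?_⟩
  refine (hirr.map_eq_zero_or (f := f') (g := g) fun a => ?_).resolve_left fun h0 => ?_
  · have : f' * a * g = 0 := by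
      refine Subtype.ext (ZeroAtInftyContinuousMap.ext fun x => ?_)
      change f'.1 x * a.1 x * g.1 x = 0
      rcases le_total (‖π f‖ / 2) ‖f.1 x‖ with h | h
      · rw [hg x h, mul_zero]
      · rw [hf' x h, zero_mul, zero_mul]
    rw [this, map_zero]
  · have := (CStarNSpace.norm_map_le π (f - f')).trans hle
    have hsub : π f = π (f - f') := by
      conv_lhs => rw [← sub_add_cancel f f', map_add, h0, add_zero]
    rw [← hsub] at this
    linarith

end Irreducible

/-! ### Haar averaging and surjectivity of evaluation -/

section Averaging

open scoped Matrix.Norms.L2Operator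
open MeasureTheory

instance Matrix.compactSpace_unitaryGroup (n : ℕ) :
    CompactSpace (Matrix.unitaryGroup (Fin n) ℂ) := by
  have : ProperSpace (Mat n) := FiniteDimensional.proper ℂ (Mat n)
  -- Since `‖U‖ ^ 2 = ‖1‖`, the radius `1 + ‖1‖` suffices; it also covers `n = 0`, where `‖1‖ = 0`.
  refine isCompact_iff_compactSpace.1 (Metric.isCompact_of_isClosed_isBounded isClosed_unitary
    ((Metric.isBounded_closedBall (x := (0 : Mat n)) (r := 1 + ‖(1 : Mat n)‖)).subset
      fun U hU => ?_))
  have h : ‖U‖ * ‖U‖ = ‖(1 : Mat n)‖ := by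
    rw [← CStarRing.norm_star_mul_self, (Unitary.mem_iff.1 hU).1]
  rw [mem_closedBall_zero_iff]
  nlinarith [norm_nonneg U, norm_nonneg (1 : Mat n)]

variable {n : ℕ} {X : Type*} [TopologicalSpace X] [MulAction (ProjUnitary n) X]

theorem ProjUnitary.continuous_conj_uncurry :
    Continuous fun p : ProjUnitary n × Mat n => ProjUnitary.conj n p.1 p.2 := by
  have hq : IsOpenQuotientMap (Prod.map (QuotientGroup.mk (s := scalarUnitaries n))
      (id : Mat n → Mat n)) := QuotientGroup.isOpenQuotientMap_mk.prodMap IsOpenQuotientMap.id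
  refine hq.isQuotientMap.continuous_iff.2 ?_
  change Continuous fun p : Matrix.unitaryGroup (Fin n) ℂ × Mat n =>
    (p.1 : Mat n) * p.2 * ((p.1⁻¹ : Matrix.unitaryGroup (Fin n) ℂ) : Mat n)
  fun_prop

/-- The conjugation by an element of `𝓤_n` as a continuous linear equivalence. -/
noncomputable def ProjUnitary.conjCLE (u : ProjUnitary n) : Mat n ≃L[ℂ] Mat n :=
  LinearEquiv.toContinuousLinearEquiv
    { (ProjUnitary.conj n u : Mat n →ₗ[ℂ] Mat n) with
      invFun := (ProjUnitary.conj n u).symm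
      left_inv := (ProjUnitary.conj n u).left_inv
      right_inv := (ProjUnitary.conj n u).right_inv }

theorem ProjUnitary.conjCLE_apply (u : ProjUnitary n) (A : Mat n) :
    ProjUnitary.conjCLE u A = ProjUnitary.conj n u A := rfl

theorem IsNSpace.continuous_conj_smul [IsNSpace n X] {g : X → Mat n} (hg : Continuous g) :
    Continuous fun p : X × ProjUnitary n => ProjUnitary.conj n p.2 (g (p.2⁻¹ • p.1)) := by
  have h1 : Continuous fun p : X × ProjUnitary n => p.2⁻¹ • p.1 :=
    (IsNSpace.continuous_smul (n := n) (X := X)).comp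
      ((continuous_inv.comp continuous_snd).prodMk continuous_fst)
  exact ProjUnitary.continuous_conj_uncurry.comp (continuous_snd.prodMk (hg.comp h1))

/-- The average of a compactly supported function over the action of `𝓤_n`. -/
noncomputable def CStarNSpace.average [IsNSpace n X] [MeasurableSpace (ProjUnitary n)]
    [BorelSpace (ProjUnitary n)] (μ : Measure (ProjUnitary n)) [IsFiniteMeasureOnCompacts μ]
    [μ.IsMulLeftInvariant] (g : X → Mat n) (hg : Continuous g) (hs : HasCompactSupport g) :
    CStarNSpace n X :=
  CStarNSpace.ofCompactSupport (fun x => ∫ u, ProjUnitary.conj n u (g (u⁻¹ • x)) ∂μ)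
    (by
      rw [← continuousOn_univ]
      exact continuousOn_integral_of_compact_support isCompact_univ
        (IsNSpace.continuous_conj_smul hg).continuousOn (by simp))
    (by
      have := IsNSpace.t2 n (X := X)
      refine HasCompactSupport.intro ((isCompact_univ.prod hs).image
        (IsNSpace.continuous_smul (n := n) (X := X))) fun x hx => ?_
      have h0 (u : ProjUnitary n) : g (u⁻¹ • x) = 0 := by
        by_contra h
        exact hx ⟨(u, u⁻¹ • x), ⟨trivial, subset_tsupport _ h⟩, smul_inv_smul u x⟩
      simp [h0])
    (fun v x => by
      -- Left invariance replaces `u` by `v * u`; then conjugation by `v` comes out of the integral.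
      rw [← integral_mul_left_eq_self _ v, ← ProjUnitary.conjCLE_apply,
        ← ContinuousLinearEquiv.integral_comp_comm]
      simp [ProjUnitary.conjCLE_apply, mul_smul])

theorem CStarNSpace.average_apply [IsNSpace n X] [MeasurableSpace (ProjUnitary n)]
    [BorelSpace (ProjUnitary n)] (μ : Measure (ProjUnitary n)) [IsFiniteMeasureOnCompacts μ]
    [μ.IsMulLeftInvariant] (g : X → Mat n) (hg : Continuous g) (hs : HasCompactSupport g) (x : X) :
    (CStarNSpace.average μ g hg hs).1 x = ∫ u, ProjUnitary.conj n u (g (u⁻¹ • x)) ∂μ := rfl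

/-- The evaluation at a point, as a linear map. -/
noncomputable def CStarNSpace.evalLinearMap (x : X) : CStarNSpace n X →ₗ[ℂ] Mat n where
  toFun f := f.1 x
  map_add' _ _ := rfl
  map_smul' _ _ := rfl

/-- Otherwise a functional `l` kills all values at `x`, while `l B = 1`. By freeness a bump `φ` at
`x` can avoid the orbit points `u⁻¹ • x` with `Re l (u . B) ≤ 0`. Averaging `φ • B` then yields a
value at `x` on which `Re l` is positive. -/
theorem CStarNSpace.exists_apply_eq [IsNSpace n X] (x : X) (B : Mat n) :
    ∃ f : CStarNSpace n X, f.1 x = B := by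
  suffices h : (CStarNSpace.evalLinearMap (n := n) x).range = ⊤ from
    LinearMap.range_eq_top.1 h B
  by_contra hne
  obtain ⟨l, hl0, hl⟩ := Submodule.exists_le_ker_of_lt_top _ (lt_top_iff_ne_top.2 hne)
  obtain ⟨B, hB⟩ : ∃ B, l B = 1 := LinearMap.surjective hl0 1
  have := IsNSpace.t2 n (X := X)
  have := IsNSpace.locallyCompact n (X := X)
  let L : Mat n →L[ℝ] ℝ :=
    Complex.reCLM.comp ((LinearMap.toContinuousLinearMap l).restrictScalars ℝ)
  have hL (A : Mat n) : L A = (l A).re := rfl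
  have hconj : Continuous fun u : ProjUnitary n => L (ProjUnitary.conj n u B) :=
    L.continuous.comp (ProjUnitary.continuous_conj_uncurry.comp
      (continuous_id.prodMk continuous_const))
  have horb : Continuous fun u : ProjUnitary n => u⁻¹ • x :=
    (IsNSpace.continuous_smul (n := n) (X := X)).comp (continuous_inv.prodMk continuous_const)
  let C : Set X := (fun u : ProjUnitary n => u⁻¹ • x) ''
    {u | L (ProjUnitary.conj n u B) ≤ 0}
  have hC : IsClosed C :=
    ((isClosed_le hconj continuous_const).isCompact.image horb).isClosed
  have hxC : x ∉ C := by
    rintro ⟨u, hu, hux⟩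
    have : u = 1 := inv_eq_one.1 (IsNSpace.free _ _ hux)
    have h1 : (l (ProjUnitary.conj n 1 B)).re ≤ 0 := this ▸ hu
    have h2 : ProjUnitary.conj n 1 B = B := by rw [map_one]; rfl
    rw [h2, hB, Complex.one_re] at h1
    linarith
  obtain ⟨φ, hφ1, hφ0, hφs, hφ⟩ := exists_continuous_one_zero_of_isCompact
    (isCompact_singleton (x := x)) hC (Set.disjoint_singleton_left.2 hxC)
  let _ : MeasurableSpace (ProjUnitary n) := borel _
  have : BorelSpace (ProjUnitary n) := ⟨rfl⟩
  let μ : Measure (ProjUnitary n) := Measure.haar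
  have hgc : Continuous fun y => φ y • B := by fun_prop
  have hgs : HasCompactSupport fun y => φ y • B := hφs.smul_right
  have hint : Integrable (fun u => ProjUnitary.conj n u (φ (u⁻¹ • x) • B)) μ :=
    Continuous.integrable_of_hasCompactSupport ((IsNSpace.continuous_conj_smul hgc).comp
      (continuous_const.prodMk continuous_id)) (HasCompactSupport.of_compactSpace _)
  have heq (u : ProjUnitary n) : L (ProjUnitary.conj n u (φ (u⁻¹ • x) • B)) =
      φ (u⁻¹ • x) * L (ProjUnitary.conj n u B) := by
    rw [← Complex.coe_smul, map_smul, Complex.coe_smul, map_smul, smul_eq_mul]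
  have hzero : L ((CStarNSpace.average μ _ hgc hgs).1 x) = 0 := by
    have : l ((CStarNSpace.average μ _ hgc hgs).1 x) = 0 :=
      hl ⟨CStarNSpace.average μ _ hgc hgs, rfl⟩
    rw [hL, this, Complex.zero_re]
  rw [CStarNSpace.average_apply, ← L.integral_comp_comm hint] at hzero
  simp only [heq] at hzero
  refine (Continuous.integral_pos_of_hasCompactSupport_nonneg_nonzero (μ := μ) (x := 1)
    ((φ.continuous.comp horb).mul hconj) (HasCompactSupport.of_compactSpace _)
    (fun u => ?_) ?_).ne' hzero
  · by_cases hu : L (ProjUnitary.conj n u B) ≤ 0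
    · have : φ (u⁻¹ • x) = 0 := hφ0 ⟨u, hu, rfl⟩
      simp [this]
    · exact mul_nonneg (hφ _).1 (not_le.1 hu).le
  · have h1 : φ x = 1 := hφ1 rfl
    simp [h1, hL, hB]

end Averaging

/-! ### The kernel is the set of functions vanishing at one point -/

section Kernel

open scoped Matrix.Norms.L2Operator
open scoped ComplexOrder

variable {n : ℕ} {X : Type*} [TopologicalSpace X] [MulAction (ProjUnitary n) X]
  {H : Type*} [NormedAddCommGroup H] [InnerProductSpace ℂ H] [CompleteSpace H]

/-- Needed for the equivariance of the quotient `g * s⁻¹`. -/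
theorem MulEquiv.map_ringInverse {M N : Type*} [MonoidWithZero M] [MonoidWithZero N]
    (e : M ≃* N) (a : M) : e (Ring.inverse a) = Ring.inverse (e a) := by
  by_cases h : IsUnit a
  · obtain ⟨u, rfl⟩ := h
    rw [Ring.inverse_unit]
    exact (Ring.inverse_unit (Units.map (e : M →* N) u)).symm
  · rw [Ring.inverse_non_unit _ h, Ring.inverse_non_unit _ (by rwa [isUnit_map_iff]), map_zero]

/-- If an ideal of `C*(X, .)` has no common zero in `X`, it contains an element that is
positive definite on a given compact set. -/
theorem CStarNSpace.exists_posDef_of_isCompact [IsNSpace n X]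
    {π : CStarNSpace n X →⋆ₙₐ[ℂ] (H →L[ℂ] H)}
    (h : ∀ x : X, ∃ f : CStarNSpace n X, π f = 0 ∧ f.1 x ≠ 0) {C : Set X} (hC : IsCompact C) :
    ∃ s : CStarNSpace n X, π s = 0 ∧ (∀ x, (s.1 x).PosSemidef) ∧ ∀ x ∈ C, (s.1 x).PosDef := by
  refine hC.induction_on (p := fun C => ∃ s : CStarNSpace n X, π s = 0 ∧
    (∀ x, (s.1 x).PosSemidef) ∧ ∀ x ∈ C, (s.1 x).PosDef) ?_ ?_ ?_ ?_
  · exact ⟨0, map_zero π, fun x => Matrix.PosSemidef.zero, by simp⟩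
  · rintro C D hst ⟨s, h0, h1, h2⟩
    exact ⟨s, h0, h1, fun x hx => h2 x (hst hx)⟩
  · rintro C D ⟨s, h0, h1, h2⟩ ⟨t, k0, k1, k2⟩
    refine ⟨s + t, by rw [map_add, h0, k0, add_zero], fun x => (h1 x).add (k1 x), fun x hx => ?_⟩
    rcases hx with hx | hx
    · exact (h2 x hx).add_posSemidef (k1 x)
    · exact Matrix.PosDef.posSemidef_add (h1 x) (k2 x hx)
  · intro x _
    -- The values of the kernel at `x` form a nonzero two-sided ideal of the simple algebra `M_n`;
    -- matrix units produce `1` explicitly.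
    obtain ⟨e, he0, he1⟩ : ∃ e : CStarNSpace n X, π e = 0 ∧ e.1 x = 1 := by
      obtain ⟨f, hf0, hfx⟩ := h x
      obtain ⟨i, j, hij⟩ : ∃ i j, f.1 x i j ≠ 0 := by
        by_contra! h0
        exact hfx (Matrix.ext h0)
      choose a ha using fun k => CStarNSpace.exists_apply_eq x (Matrix.single k i (1 : ℂ))
      choose b hb using fun k =>
        CStarNSpace.exists_apply_eq x (Matrix.single j k ((f.1 x i j)⁻¹))
      refine ⟨∑ k, a k * f * b k, by simp [map_sum, map_mul, hf0], ?_⟩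
      change CStarNSpace.evalLinearMap x (∑ k, a k * f * b k) = 1
      rw [map_sum]
      have hk (k : Fin n) : CStarNSpace.evalLinearMap x (a k * f * b k) =
          Matrix.single k k (1 : ℂ) := by
        change (a k).1 x * f.1 x * (b k).1 x = _
        rw [ha, hb]
        simp [Matrix.single_mul_mul_single, hij]
      simp only [hk]
      exact Matrix.sum_single_one
    refine ⟨{y | IsUnit (e.1 y)}, mem_nhdsWithin_of_mem_nhds ?_, star e * e,
      by rw [map_mul, he0, mul_zero], fun y => Matrix.posSemidef_conjTranspose_mul_self (e.1 y),
      fun y hy => Matrix.PosDef.conjTranspose_mul_self _ (Matrix.mulVec_injective_of_isUnit hy)⟩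
    exact (Units.isOpen.preimage (map_continuous e.1)).mem_nhds (by simp [he1])

/-- The kernel of a nonzero representation of `C*(X, .)` has a common zero in `X`. -/
theorem CStarNSpace.exists_forall_map_eq_zero [IsNSpace n X]
    {π : CStarNSpace n X →⋆ₙₐ[ℂ] (H →L[ℂ] H)} (hπ : π ≠ 0) :
    ∃ x : X, ∀ f : CStarNSpace n X, π f = 0 → f.1 x = 0 := by
  have := IsNSpace.t2 n (X := X)
  by_contra! h
  obtain ⟨f, hf⟩ : ∃ f, π f ≠ 0 := by
    by_contra! h0
    exact hπ (NonUnitalStarAlgHom.ext h0)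
  have hpos : 0 < ‖π f‖ := norm_pos_iff.2 hf
  obtain ⟨g, hle, hg⟩ := CStarNSpace.exists_truncation f (half_pos hpos)
  have hC := f.1.isCompact_le_norm (half_pos hpos)
  obtain ⟨s, hs0, -, hs⟩ := CStarNSpace.exists_posDef_of_isCompact h hC
  have hunit : IsOpen {x | IsUnit (s.1 x)} := Units.isOpen.preimage (map_continuous s.1)
  have hgC (x : X) (hx : x ∉ {x | ‖π f‖ / 2 ≤ ‖f.1 x‖}) : g.1 x = 0 := hg x (not_le.1 hx).le
  -- `s` is invertible on the compact set, and `g` vanishes on its open complement, where the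
  -- default value `0` of `Ring.inverse` is harmless.
  have hcont : Continuous fun x => g.1 x * Ring.inverse (s.1 x) := by
    refine continuous_iff_continuousAt.2 fun x => ?_
    by_cases hx : x ∈ {x | ‖π f‖ / 2 ≤ ‖f.1 x‖}
    · obtain ⟨u, hu⟩ := (hs x hx).isUnit
      have hinv : ContinuousAt (fun y => Ring.inverse (s.1 y)) x :=
        ContinuousAt.comp (g := Ring.inverse) (hu ▸ NormedRing.inverse_continuousAt u)
          (map_continuous s.1).continuousAt
      exact (map_continuous g.1).continuousAt.mul hinv
    · refine ContinuousAt.congr (f := fun _ => 0) continuousAt_const ?_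
      filter_upwards [hC.isClosed.isOpen_compl.mem_nhds hx] with y hy
      rw [hgC y hy, zero_mul]
  let q : CStarNSpace n X := CStarNSpace.ofCompactSupport _ hcont
    (HasCompactSupport.intro hC fun x hx => by rw [hgC x hx, zero_mul]) fun u x => by
      rw [CStarNSpace.apply_smul, CStarNSpace.apply_smul, map_mul]
      congr 1
      exact (MulEquiv.map_ringInverse (ProjUnitary.conj n u : Mat n ≃* Mat n) _).symm
  have hgq : g = q * s := by
    refine Subtype.ext (ZeroAtInftyContinuousMap.ext fun x => ?_)
    change g.1 x = g.1 x * Ring.inverse (s.1 x) * s.1 x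
    by_cases hx : x ∈ {x | ‖π f‖ / 2 ≤ ‖f.1 x‖}
    · rw [Ring.inverse_mul_cancel_right _ _ (hs x hx).isUnit]
    · rw [hgC x hx, zero_mul, zero_mul]
  have hg0 : π g = 0 := by rw [hgq, map_mul, hs0, mul_zero]
  have hle' := (CStarNSpace.norm_map_le π (f - g)).trans hle
  have hsub : π f = π (f - g) := by
    conv_lhs => rw [← sub_add_cancel f g, map_add, hg0, add_zero]
  rw [← hsub] at hle'
  linarith

theorem IsIrreducibleRep.exists_map_eq_zero_iff [IsNSpace n X]
    {π : CStarNSpace n X →⋆ₙₐ[ℂ] (H →L[ℂ] H)} (hirr : IsIrreducibleRep π) (hπ : π ≠ 0) :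
    ∃ x : X, ∀ f : CStarNSpace n X, π f = 0 ↔ f.1 x = 0 := by
  obtain ⟨x, hx⟩ := CStarNSpace.exists_forall_map_eq_zero hπ
  refine ⟨x, fun f => ⟨hx f, fun hfx => ?_⟩⟩
  by_contra hf
  obtain ⟨ε, hε, h⟩ := hirr.exists_pos_map_eq_zero hf
  obtain ⟨g, hg⟩ := CStarNSpace.exists_apply_eq (n := n) x 1
  -- The cut-off is `1` at `x` because `f x = 0`, and `0` wherever `‖f‖ ≥ ε`.
  have hg0 := hx _ (h (CStarNSpace.invMul (fun y => max 0 (1 - ‖f.1 y‖ / ε)) (by fun_prop)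
    (fun y => by
      have : 0 ≤ ‖f.1 y‖ / ε := by positivity
      rw [abs_of_nonneg (le_max_left _ _)]
      exact max_le zero_le_one (by linarith))
    (fun u y => by simp only [CStarNSpace.norm_apply_smul]) g) fun y hy => by
      have : 1 ≤ ‖f.1 y‖ / ε := (one_le_div hε).2 hy
      simp [max_eq_left (sub_nonpos.2 this)])
  have h10 : (1 : Mat n) = 0 := by simpa [hfx, hg] using hg0
  -- `1 = 0` in `M_n` only means `n = 0`; then `f = 0`, which contradicts `π f ≠ 0`.
  have hsub : Subsingleton (Mat n) := subsingleton_of_zero_eq_one h10.symm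
  refine hf ?_
  have : f = 0 := Subtype.ext (ZeroAtInftyContinuousMap.ext fun y => Subsingleton.elim _ _)
  rw [this, map_zero]

/-- A representation of `C*(X, .)` that vanishes at the functions vanishing at `x` factors through
the evaluation at `x`. -/
theorem CStarNSpace.exists_factor [IsNSpace n X] {π : CStarNSpace n X →⋆ₙₐ[ℂ] (H →L[ℂ] H)}
    {x : X} (hx : ∀ f : CStarNSpace n X, f.1 x = 0 → π f = 0) :
    ∃ ρ : Mat n →⋆ₙₐ[ℂ] (H →L[ℂ] H), ∀ f : CStarNSpace n X, π f = ρ (f.1 x) := by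
  have hcongr (f g : CStarNSpace n X) (h : f.1 x = g.1 x) : π f = π g := by
    have h0 : π (f - g) = 0 := hx _ (sub_eq_zero.2 h)
    conv_lhs => rw [← sub_add_cancel f g, map_add, h0, zero_add]
  -- An arbitrary section of evaluation: it respects the operations only modulo functions vanishing
  -- at `x`, which `π` kills.
  choose s hs using CStarNSpace.exists_apply_eq (n := n) x
  refine ⟨{ toFun := fun B => π (s B)
            map_smul' := fun c B => ?_
            map_zero' := ?_
            map_add' := fun B C => ?_
            map_mul' := fun B C => ?_
            map_star' := fun B => ?_ }, fun f => hcongr _ _ (hs _).symm⟩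
  · refine (hcongr _ (c • s B) ?_).trans (map_smul π c (s B))
    change _ = c • (s B).1 x
    rw [hs, hs]
  · exact hx _ (hs 0)
  · refine (hcongr _ (s B + s C) ?_).trans (map_add π (s B) (s C))
    change _ = (s B).1 x + (s C).1 x
    rw [hs, hs, hs]
  · refine (hcongr _ (s B * s C) ?_).trans (map_mul π (s B) (s C))
    change _ = (s B).1 x * (s C).1 x
    rw [hs, hs, hs]
  · refine (hcongr _ (star (s B)) ?_).trans (map_star π (s B))
    change _ = star ((s B).1 x)
    rw [hs, hs]

end Kernel

/-! ### Irreducible representations of the full matrix algebra -/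

section MatrixRepresentation

variable {n : ℕ} {H : Type*} [NormedAddCommGroup H] [InnerProductSpace ℂ H] [CompleteSpace H]

/-- A nonzero irreducible representation of `M_n` is equivalent to the identity
representation. -/
theorem IsIrreducibleRep.exists_isometry_of_matrix {ρ : Mat n →⋆ₙₐ[ℂ] (H →L[ℂ] H)} (hρ : ρ ≠ 0)
    (hirr : IsIrreducibleRep ρ) :
    ∃ W : H ≃ₗᵢ[ℂ] EuclideanSpace ℂ (Fin n), ∀ (B : Mat n) (v : H),
      W (ρ B v) = Matrix.toEuclideanCLM (n := Fin n) (𝕜 := ℂ) B (W v) := by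
  let E (i j : Fin n) : Mat n := Matrix.single i j 1
  have hE (B : Mat n) : B = ∑ i, ∑ j, B i j • E i j := by
    conv_lhs => rw [Matrix.matrix_eq_sum_single B]
    simp [E, Matrix.smul_single]
  obtain ⟨k, hk⟩ : ∃ k, ρ (E k k) ≠ 0 := by
    by_contra! h
    refine hρ (NonUnitalStarAlgHom.ext fun B => ?_)
    have hij (i j : Fin n) : ρ (E i j) = 0 := by
      have : E i j = E i i * E i j := by simp [E]
      rw [this, map_mul, h, zero_mul]
    rw [hE B]
    simp [map_sum, map_smul, hij]
  obtain ⟨w, hw⟩ : ∃ w, ρ (E k k) w ≠ 0 := by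
    by_contra! h
    exact hk (ContinuousLinearMap.ext h)
  let v : H := (‖ρ (E k k) w‖⁻¹ : ℂ) • ρ (E k k) w
  have hv1 : ‖v‖ = 1 := norm_smul_inv_norm hw
  have hv : ρ (E k k) v = v := by
    have : ρ (E k k) (ρ (E k k) w) = ρ (E k k) w := by
      rw [← mul_apply_eq_comp, ← map_mul]
      simp [E]
    simp only [v, map_smul, this]
  -- Starting from a unit vector `v` fixed by `ρ (E k k)`, the vectors `b i` transform like the
  -- standard basis. Their span is finite-dimensional, hence closed, so irreducibility makes it all
  -- of `H`.
  let b (i : Fin n) : H := ρ (E i k) v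
  have hmul (i j l : Fin n) : ρ (E i j) (b l) = if j = l then b i else 0 := by
    simp only [b]
    rw [← mul_apply_eq_comp, ← map_mul]
    split_ifs with h
    · subst h; simp [E]
    · simp [E, h]
  have hb (B : Mat n) (j : Fin n) : ρ B (b j) = ∑ i, B i j • b i := by
    conv_lhs => rw [hE B]
    simp [map_sum, map_smul, hmul]
  have hon : Orthonormal ℂ b := by
    rw [orthonormal_iff_ite]
    intro i j
    have hstar : ρ (E i k) = ContinuousLinearMap.adjoint (ρ (E k i)) := by
      rw [← ContinuousLinearMap.star_eq_adjoint, ← map_star]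
      simp [E, Matrix.star_eq_conjTranspose]
    change inner ℂ (ρ (E i k) v) (b j) = _
    rw [hstar, ContinuousLinearMap.adjoint_inner_left, hmul]
    split_ifs with h
    · change inner ℂ v (ρ (E k k) v) = 1
      rw [hv, inner_self_eq_norm_sq_to_K, hv1]
      simp
    · simp
  have : FiniteDimensional ℂ (Submodule.span ℂ (Set.range b)) :=
    FiniteDimensional.span_of_finite ℂ (Set.finite_range b)
  have hspan : Submodule.span ℂ (Set.range b) = ⊤ := by
    refine (hirr _ (Submodule.closed_of_finiteDimensional _) fun B u hu => ?_).resolve_left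
      fun h => ?_
    · induction hu using Submodule.span_induction with
      | mem x hx =>
        obtain ⟨j, rfl⟩ := hx
        rw [hb]
        exact Submodule.sum_mem _ fun i _ =>
          Submodule.smul_mem _ _ (Submodule.subset_span ⟨i, rfl⟩)
      | zero => simp
      | add x y _ _ hx hy => rw [map_add]; exact Submodule.add_mem _ hx hy
      | smul c x _ hx => rw [map_smul]; exact Submodule.smul_mem _ _ hx
    · have hk0 : b k = 0 := by
        rw [← Submodule.mem_bot ℂ, ← h]
        exact Submodule.subset_span ⟨k, rfl⟩
      simpa [hk0] using hon.1 k
  let ob : OrthonormalBasis (Fin n) ℂ H := OrthonormalBasis.mk hon hspan.ge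
  have hob (i : Fin n) : ob i = b i := by simp [ob]
  refine ⟨ob.repr, fun B u => ?_⟩
  suffices h : (ob.repr : H →ₗ[ℂ] EuclideanSpace ℂ (Fin n)) ∘ₗ (ρ B : H →ₗ[ℂ] H) =
      (Matrix.toEuclideanCLM (n := Fin n) (𝕜 := ℂ) B :
        EuclideanSpace ℂ (Fin n) →ₗ[ℂ] EuclideanSpace ℂ (Fin n)) ∘ₗ
      (ob.repr : H →ₗ[ℂ] EuclideanSpace ℂ (Fin n)) from LinearMap.congr_fun h u
  refine ob.toBasis.ext fun j => ?_
  change ob.repr (ρ B (ob.toBasis j)) =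
    Matrix.toEuclideanCLM (n := Fin n) (𝕜 := ℂ) B (ob.repr (ob.toBasis j))
  rw [OrthonormalBasis.coe_toBasis, hob, hb, map_sum]
  simp only [map_smul, ← hob, ob.repr_self]
  ext i
  simp [Pi.single_apply]

end MatrixRepresentation

/-! ### Change of identification and conclusion -/

theorem CStarNSpace.exists_unitary_conj {n : ℕ} {X : Type*} [TopologicalSpace X]
    [MulAction (ProjUnitary n) X]
    (V : EuclideanSpace ℂ (Fin n) ≃ₗᵢ[ℂ] EuclideanSpace ℂ (Fin n)) (x : X) :
    ∃ u : ProjUnitary n, ∀ (f : CStarNSpace n X) (v : EuclideanSpace ℂ (Fin n)),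
      V (Matrix.toEuclideanCLM (n := Fin n) (𝕜 := ℂ) (f.1 x) v) =
        Matrix.toEuclideanCLM (n := Fin n) (𝕜 := ℂ) (f.1 (u • x)) (V v) := by
  let T := Matrix.toEuclideanCLM (n := Fin n) (𝕜 := ℂ)
  let U' := Unitary.linearIsometryEquiv.symm V
  have hU' (v) : (U' : EuclideanSpace ℂ (Fin n) →L[ℂ] EuclideanSpace ℂ (Fin n)) v = V v := rfl
  obtain ⟨A, hA⟩ : ∃ A, T A = U' := EquivLike.surjective T _
  let U : Matrix.unitaryGroup (Fin n) ℂ := ⟨A, Matrix.mem_unitaryGroup_iff.2 <|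
    EquivLike.injective T <| by
      rw [map_mul, map_star, hA, Unitary.mul_star_self_of_mem U'.2, map_one]⟩
  have hU : T (U : Mat n) = U' := hA
  -- `V` is multiplication by `U`, and equivariance gives `U * f x * U⁻¹ = f (u • x)`.
  refine ⟨QuotientGroup.mk U, fun f v => ?_⟩
  rw [CStarNSpace.apply_smul, ProjUnitary.conj_mk]
  change V (T (f.1 x) v) = T _ (V v)
  rw [← hU', ← hU', ← hU, ← mul_apply_eq_comp, ← mul_apply_eq_comp, ← map_mul, ← map_mul, mul_assoc,
    ← Submonoid.coe_mul, inv_mul_cancel, Submonoid.coe_one, mul_one]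

theorem mainTheorem7 (n : ℕ) (hn : 1 ≤ n) {X : Type*} [TopologicalSpace X]
    [MulAction (ProjUnitary n) X] [IsNSpace n X]
    {H : Type*} [NormedAddCommGroup H] [InnerProductSpace ℂ H] [CompleteSpace H]
    (π : CStarNSpace n X →⋆ₙₐ[ℂ] (H →L[ℂ] H)) (hπ : π ≠ 0) (hirr : IsIrreducibleRep π) :
    FiniteDimensional ℂ H ∧ Module.finrank ℂ H = n ∧
      (∃ x : X, ∃ W : H ≃ₗᵢ[ℂ] EuclideanSpace ℂ (Fin n), ∀ f : CStarNSpace n X, ∀ v : H,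
        W (π f v) = Matrix.toEuclideanCLM (n := Fin n) (𝕜 := ℂ) (f.1 x) (W v)) ∧
      ∀ W : H ≃ₗᵢ[ℂ] EuclideanSpace ℂ (Fin n), ∃ x : X, ∀ f : CStarNSpace n X, ∀ v : H,
        W (π f v) = Matrix.toEuclideanCLM (n := Fin n) (𝕜 := ℂ) (f.1 x) (W v) := by
  obtain ⟨x, hx⟩ := hirr.exists_map_eq_zero_iff hπ
  obtain ⟨ρ, hρ⟩ := CStarNSpace.exists_factor fun f => (hx f).2
  have hρ0 : ρ ≠ 0 := by
    rintro rfl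
    exact hπ (NonUnitalStarAlgHom.ext fun f => by simp [hρ])
  have hρirr : IsIrreducibleRep ρ := fun K hK hinv =>
    hirr K hK fun f v hv => hρ f ▸ hinv (f.1 x) v hv
  obtain ⟨W, hW⟩ := hρirr.exists_isometry_of_matrix hρ0
  have hWπ (f : CStarNSpace n X) (v : H) :
      W (π f v) = Matrix.toEuclideanCLM (n := Fin n) (𝕜 := ℂ) (f.1 x) (W v) := by
    rw [hρ, hW]
  have hfd : FiniteDimensional ℂ H := W.symm.toLinearEquiv.finiteDimensional
  refine ⟨hfd, by simpa using W.toLinearEquiv.finrank_eq, ⟨x, W, hWπ⟩, fun W' => ?_⟩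
  obtain ⟨u, hu⟩ := CStarNSpace.exists_unitary_conj (X := X) (W.symm.trans W') x
  refine ⟨u • x, fun f v => ?_⟩
  have h := hu f (W v)
  rw [← hWπ] at h
  simpa using h
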